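/- Let $(\overline B,\overline\nabla=\overline\nabla^{\overline g}+\overline{\mathbb K},\overline g,\phi,\xi)$ be a non-empty Kenmotsu statistical manifold of dimension $2s+1$, $s\ge 0$. That is, $(\overline g,\phi,\xi)$ is an almost contact metric structure with $\eta=\overline g(\cdot,\xi)$ (so $\phi^2=-\mathrm{Id}+\eta\otimes\xi$, $\phi\xi=0$, $\eta(\xi)=1$, $\overline g(\phi E,\phi F)=\overline g(E,F)-\eta(E)\eta(F)$) satisfying the Kenmotsu condition $(\overline\nabla^{\overline g}_E\phi)F=\overline g(\phi E,F)\xi-\eta(F)\phi E$ for the Levi-Civita connection $\overline\nabla^{\overline g}$; $(\overline\nabla,\overline g)$ is a statistical structure ($\overline\nabla$ is torsion-free with a torsion-free $\overline g$-dual connection, and $\overline\nabla\,\overline g$ is symmetric); and $\overline{\mathbb K}(E,\phi F)=-\phi\overline{\mathbb K}(E,F)$. Suppose that $\overline{\mathbb K}(E,F)=\beta\,\eta(E)\eta(F)\,\xi$ for a smooth function $\beta$ on $\overline B$. Let $\overline R$ be the statistical curvature tensor field $\overline R(E,F)G=\overline R^{\overline g}(E,F)G+[\overline{\mathbb K}_E,\overline{\mathbb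 K}_F]G$, where $\overline R^{\overline g}$ is the curvature tensor of $\overline\nabla^{\overline g}$ (the same statement also holds with $\overline R$ the curvature tensor of $\overline\nabla$ throughout), and suppose that $\overline B$ is of constant $\phi$-sectional curvature $\overline c\in\mathbb R$, i.e. $$\begin{aligned}\overline R(E,F)G={}&\tfrac{\overline c-3}{4}\{\overline g(F,G)E-\overline g(E,G)F\}+\tfrac{\overline c+1}{4}\{\overline g(\phi F,G)\phi E-\overline g(\phi E,G)\phi F-2\overline g(\phi E,F)\phi G\\&-\eta(F)\eta(G)E+\eta(E)\eta(G)F+\eta(F)\overline g(G,E)\xi-\eta(E)\overline g(G,F)\xi\}.\end{aligned}$$ Let $\overline{Ric}(E,F)=\sum_i\overline g(\overline R(e_i,E)F,e_i)$ for an orthonormal frame $(e_i)$. Then: 1. $\overline{Ric}(E,F)=t_1\,\overline g(E,F)+t_2\,\eta(E)\eta(F)$ with $t_1=\dfrac{\overline c(s+1)-3s+1}{2}$ and $t_2=\dfrac{-(\overline c+1)(s+1)}{2}$; moreover, if $s\ge 1$, then $\overline B$ is not Ricci-flat, i.e. $\overline{Ric}$ does not vanish identically. 2. $\overline{Ric}(E,\xi)=-2s\,\eta(E)$.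 3. $\overline{Ric}(\phi E,\phi F)=\overline{Ric}(E,F)+2s\,\eta(E)\eta(F)$. -/

import Mathlib

open Bundle
open scoped Manifold ContDiff

noncomputable section

namespace Kenmotsu

variable {E : Type*} [NormedAddCommGroup E] [NormedSpace ℝ E] [FiniteDimensional ℝ E]
  {H : Type*} [TopologicalSpace H] {I : ModelWithCorners ℝ E H}
  {M : Type*} [TopologicalSpace M] [ChartedSpace H M] [IsManifold I ∞ M]

variable (I M) in
/-- An affine connection on `M` (not assumed smooth): a covariant derivative on the tangent
bundle. In Mathlib's argument order `D Y x (X x)` is the value of `∇_X Y` at `x`. -/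
abbrev AffineConnection := CovariantDerivative I E (fun x : M ↦ TangentSpace I x)

/-- A vector field, defined on all of `M`, that is smooth at the point `x`. -/
def SmoothAt (X : ∀ x : M, TangentSpace I x) (x : M) : Prop := CMDiffAt ∞ (T% X) x

/-- The curvature tensor field of an affine connection, on vector fields:
`R(X,Y)Z = ∇_X ∇_Y Z - ∇_Y ∇_X Z - ∇_[X,Y] Z`. -/
def curvature (D : AffineConnection I M) (X Y Z : ∀ x : M, TangentSpace I x) (x : M) :
    TangentSpace I x :=
  D (fun y ↦ D Z y (Y y)) x (X x) - D (fun y ↦ D Z y (X y)) x (Y x)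
    - D Z x (VectorField.mlieBracket I X Y x)

/-- The difference tensor `K = ∇ - ∇⁰`, with `differenceTensor D D₀ x u v = K(u, v)`, so that
`K(X, Y) = ∇_X Y - ∇⁰_X Y`. -/
def differenceTensor (D D₀ : AffineConnection I M) (x : M) (u v : TangentSpace I x) :
    TangentSpace I x :=
  D.difference D₀ x v u

/-- The statistical curvature tensor field of `(∇, g)`, where `D₀` is the Levi-Civita connection
of `g` and `K = ∇ - ∇⁰`: `S(X,Y)Z = R⁰(X,Y)Z + K_X K_Y Z - K_Y K_X Z`. -/
def statisticalCurvature (D D₀ : AffineConnection I M) (X Y Z : ∀ x : M, TangentSpace I x)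
    (x : M) : TangentSpace I x :=
  curvature D₀ X Y Z x
    + (differenceTensor D D₀ x (X x) (differenceTensor D D₀ x (Y x) (Z x))
      - differenceTensor D D₀ x (Y x) (differenceTensor D D₀ x (X x) (Z x)))

variable [RiemannianBundle (fun x : M ↦ TangentSpace I x)]
  [IsContMDiffRiemannianBundle I ∞ E (fun x : M ↦ TangentSpace I x)]

/-- `D₀` is the Levi-Civita connection: smooth, torsion-free and metric,
`(∇⁰_u g)(v, w) = 0`. In Mathlib's argument order `D₀.derivMetricTensor x v w u` is
`(∇⁰_u g)(v, w) = u g(V, W) - g(∇⁰_u V, W) - g(V, ∇⁰_u W)`. -/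
structure IsLeviCivita (D₀ : AffineConnection I M) : Prop where
  smooth : D₀.ContMDiffCovariantDerivative ∞
  torsion_free : D₀.torsion = 0
  metric : ∀ (x : M) (u v w : TangentSpace I x), D₀.derivMetricTensor x v w u = 0

/-- `D` and `D'` are dual with respect to `g`: `X g(Y,Z) = g(∇_X Y, Z) + g(Y, ∇'_X Z)`. -/
def IsDual (D D' : AffineConnection I M) : Prop :=
  ∀ (x : M) (Y Z : ∀ x : M, TangentSpace I x), SmoothAt Y x → SmoothAt Z x →
    ∀ u : TangentSpace I x,
      (d% (fun y ↦ inner ℝ (Y y) (Z y)) x) u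
        = inner ℝ (D Y x u) (Z x) + inner ℝ (Y x) (D' Z x u)

/-- `(D, g)` is a statistical structure: `D` is a smooth torsion-free affine connection with a
smooth torsion-free dual connection, and `∇g` is symmetric, `(∇_u g)(v, w) = (∇_v g)(u, w)`.
In Mathlib's argument order `D.derivMetricTensor x v w u` is `(∇_u g)(v, w)`. -/
structure IsStatistical (D : AffineConnection I M) : Prop where
  smooth : D.ContMDiffCovariantDerivative ∞
  torsion_free : D.torsion = 0
  codazzi : ∀ (x : M) (u v w : TangentSpace I x),
    D.derivMetricTensor x v w u = D.derivMetricTensor x u w v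
  dual : ∃ D' : AffineConnection I M,
    D'.ContMDiffCovariantDerivative ∞ ∧ D'.torsion = 0 ∧ IsDual D D'

/-- `(φ, ξ)` together with the metric `g` is an almost contact metric structure with 1-form
`η = g(·, ξ)`: `φ² = -1 + η ⊗ ξ`, `φξ = 0`, `η(ξ) = 1` and `g(φu, φv) = g(u,v) - η(u)η(v)`. -/
structure IsAlmostContactMetric (φ : ∀ x : M, TangentSpace I x →L[ℝ] TangentSpace I x)
    (ξ : ∀ x : M, TangentSpace I x) : Prop where
  smooth_phi : ContMDiff I (I.prod 𝓘(ℝ, E →L[ℝ] E)) ∞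
    (fun x ↦ Bundle.TotalSpace.mk' (E →L[ℝ] E)
      (E := fun x : M ↦ TangentSpace I x →L[ℝ] TangentSpace I x) x (φ x))
  smooth_xi : CMDiff ∞ (T% ξ)
  phi_phi : ∀ (x : M) (u : TangentSpace I x), φ x (φ x u) = -u + inner ℝ u (ξ x) • ξ x
  phi_xi : ∀ x : M, φ x (ξ x) = 0
  xi_xi : ∀ x : M, inner ℝ (ξ x) (ξ x) = 1
  inner_phi : ∀ (x : M) (u v : TangentSpace I x),
    inner ℝ (φ x u) (φ x v) = inner ℝ u v - inner ℝ u (ξ x) * inner ℝ v (ξ x)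

/-- The almost contact metric structure `(g, φ, ξ)` is a Kenmotsu structure: with the Levi-Civita
connection `D₀`, `(∇⁰_X φ) Y = g(φX, Y) ξ - η(Y) φX`. -/
structure IsKenmotsu (D₀ : AffineConnection I M)
    (φ : ∀ x : M, TangentSpace I x →L[ℝ] TangentSpace I x)
    (ξ : ∀ x : M, TangentSpace I x) : Prop extends IsAlmostContactMetric φ ξ where
  nabla_phi : ∀ (x : M) (Y : ∀ x : M, TangentSpace I x), SmoothAt Y x →
    ∀ u : TangentSpace I x,
      D₀ (fun y ↦ φ y (Y y)) x u - φ x (D₀ Y x u)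
        = inner ℝ (φ x u) (Y x) • ξ x - inner ℝ (Y x) (ξ x) • φ x u

/-- `(D = D₀ + K, g, φ, ξ)` is a Kenmotsu statistical structure: `D₀` is the Levi-Civita
connection of `g`, `(g, φ, ξ)` is Kenmotsu, `(D, g)` is statistical and `K(u, φv) = -φ K(u, v)`. -/
structure IsKenmotsuStatistical (D D₀ : AffineConnection I M)
    (φ : ∀ x : M, TangentSpace I x →L[ℝ] TangentSpace I x)
    (ξ : ∀ x : M, TangentSpace I x) : Prop where
  leviCivita : IsLeviCivita D₀
  kenmotsu : IsKenmotsu D₀ φ ξ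
  statistical : IsStatistical D
  skew : ∀ (x : M) (u v : TangentSpace I x),
    differenceTensor D D₀ x u (φ x v) = -φ x (differenceTensor D D₀ x u v)

/-- The curvature field `R` has constant `φ`-sectional curvature `c`. -/
def HasConstantPhiSectionalCurvature
    (R : (X Y Z : ∀ x : M, TangentSpace I x) → ∀ x : M, TangentSpace I x)
    (φ : ∀ x : M, TangentSpace I x →L[ℝ] TangentSpace I x)
    (ξ : ∀ x : M, TangentSpace I x) (c : ℝ) : Prop :=
  ∀ (x : M) (X Y Z : ∀ x : M, TangentSpace I x), SmoothAt X x → SmoothAt Y x → SmoothAt Z x →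
    R X Y Z x =
      ((c - 3) / 4) • (inner ℝ (Y x) (Z x) • X x - inner ℝ (X x) (Z x) • Y x)
      + ((c + 1) / 4) •
        (inner ℝ (φ x (Y x)) (Z x) • φ x (X x) - inner ℝ (φ x (X x)) (Z x) • φ x (Y x)
          - (2 * inner ℝ (φ x (X x)) (Y x)) • φ x (Z x)
          - (inner ℝ (Y x) (ξ x) * inner ℝ (Z x) (ξ x)) • X x
          + (inner ℝ (X x) (ξ x) * inner ℝ (Z x) (ξ x)) • Y x
          + (inner ℝ (Y x) (ξ x) * inner ℝ (Z x) (X x)) • ξ x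
          - (inner ℝ (X x) (ξ x) * inner ℝ (Z x) (Y x)) • ξ x)

/-- The Ricci tensor at `x` of a curvature tensor field `R`, the trace of `w ↦ R(w, u)v`:
`Ric(u, v) = ∑ i, g(R(e_i, u) v, e_i)` for an orthonormal basis `e` of the tangent space. Tangent
vectors at `x` are extended to vector fields smooth near `x`; the value of a tensor field at `x`
does not depend on the extension. -/
def ricci (R : (X Y Z : ∀ x : M, TangentSpace I x) → ∀ x : M, TangentSpace I x)
    (x : M) (u v : TangentSpace I x) : ℝ :=
  haveI : FiniteDimensional ℝ (TangentSpace I x) := inferInstanceAs (FiniteDimensional ℝ E)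
  ∑ i, inner ℝ
    (R (FiberBundle.extend E (stdOrthonormalBasis ℝ (TangentSpace I x) i))
      (FiberBundle.extend E u) (FiberBundle.extend E v) x)
    (stdOrthonormalBasis ℝ (TangentSpace I x) i)

/-- `R` is Ricci-flat: its Ricci tensor vanishes identically. -/
def IsRicciFlat (R : (X Y Z : ∀ x : M, TangentSpace I x) → ∀ x : M, TangentSpace I x) : Prop :=
  ∀ (x : M) (u v : TangentSpace I x), ricci R x u v = 0

end Kenmotsu

end

/-!
When the curvature has the constant `φ`-sectional form, the Ricci tensor is a trace that can
be taken one tangent space at a time. Two facts about a single tangent space `V` carry it.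

An almost contact metric structure makes `φ` skew-adjoint: comparing `φ² (φ v)` with `φ (φ² v)`
gives `η(φ v) ξ = 0`, and substituting `φ v` into the compatibility of `φ` with the metric then
gives `g(φ u, v) = -g(u, φ v)`. Hence `φ` has trace zero, while
`∑ g(φ eᵢ, u) g(φ v, eᵢ) = g(φ² v, u) = -g(u, v) + η(u) η(v)`.

Expanding the curvature and summing every product of two inner products by Parseval's identity
leaves `g(u, v)` with coefficient `2s (c - 3) / 4 + 2 (c + 1) / 4` and `η(u) η(v)` with coefficient
`-(2s + 2) (c + 1) / 4`. These add up to `-2s`, which yields the value of `Ric(u, ξ)`, hence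
`Ric(ξ, ξ) = -2s ≠ 0` for `s ≥ 1`, and the effect of `φ` on both arguments.
-/

namespace Kenmotsu

section Pointwise

open scoped RealInnerProductSpace

variable {V : Type*} [NormedAddCommGroup V] [InnerProductSpace ℝ V] {φ : V →ₗ[ℝ] V} {ξ : V}

theorem inner_phi_xi_eq_zero (hφφ : ∀ u, φ (φ u) = -u + ⟪u, ξ⟫ • ξ) (hφξ : φ ξ = 0)
    (hξ : ⟪ξ, ξ⟫ = 1) (v : V) : ⟪φ v, ξ⟫ = 0 := by
  have h := hφφ (φ v)
  rw [hφφ v, map_add, map_neg, map_smul, hφξ, smul_zero, add_zero] at h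
  have h0 : ⟪φ v, ξ⟫ • ξ = 0 := by simpa using h.symm
  simpa only [real_inner_smul_left, hξ, mul_one, inner_zero_left] using
    congrArg (fun w ↦ ⟪w, ξ⟫) h0

theorem inner_phi_left_eq_neg (hφφ : ∀ u, φ (φ u) = -u + ⟪u, ξ⟫ • ξ) (hφξ : φ ξ = 0)
    (hξ : ⟪ξ, ξ⟫ = 1) (hφ : ∀ u v, ⟪φ u, φ v⟫ = ⟪u, v⟫ - ⟪u, ξ⟫ * ⟪v, ξ⟫) (u v : V) :
    ⟪φ u, v⟫ = -⟪u, φ v⟫ := by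
  have h := hφ u (φ v)
  simp only [hφφ v, inner_add_right, inner_neg_right, inner_smul_right,
    inner_phi_xi_eq_zero hφφ hφξ hξ] at h
  linarith

/-- The trace of `w ↦ R(w, u)v` on one tangent space, for the curvature form `R` of constant
`φ`-sectional curvature `c`. -/
theorem sum_inner_constantPhiSectionalCurvature {ι : Type*} [Fintype ι]
    (e : OrthonormalBasis ι ℝ V) (s : ℕ) (hι : Fintype.card ι = 2 * s + 1)
    (hφφ : ∀ u, φ (φ u) = -u + ⟪u, ξ⟫ • ξ) (hφξ : φ ξ = 0)
    (hξ : ⟪ξ, ξ⟫ = 1) (hφ : ∀ u v, ⟪φ u, φ v⟫ = ⟪u, v⟫ - ⟪u, ξ⟫ * ⟪v, ξ⟫) (c : ℝ) (u v : V) :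
    ∑ i, ⟪((c - 3) / 4) • (⟪u, v⟫ • e i - ⟪e i, v⟫ • u)
      + ((c + 1) / 4) •
        (⟪φ u, v⟫ • φ (e i) - ⟪φ (e i), v⟫ • φ u - (2 * ⟪φ (e i), u⟫) • φ v
          - (⟪u, ξ⟫ * ⟪v, ξ⟫) • e i + (⟪e i, ξ⟫ * ⟪v, ξ⟫) • u
          + (⟪u, ξ⟫ * ⟪v, e i⟫) • ξ - (⟪e i, ξ⟫ * ⟪v, u⟫) • ξ), e i⟫
      = ((c * (s + 1) - 3 * s + 1) / 2) * ⟪u, v⟫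
        + (-((c + 1) * (s + 1)) / 2) * (⟪u, ξ⟫ * ⟪v, ξ⟫) := by
  have hskew := inner_phi_left_eq_neg hφφ hφξ hξ hφ
  have hdiag (w : V) : ⟪φ w, w⟫ = 0 := by
    linarith [hskew w w, real_inner_comm w (φ w)]
  have hpar (a b : V) : ∑ i, ⟪e i, a⟫ * ⟪b, e i⟫ = ⟪a, b⟫ := by
    rw [real_inner_comm, ← e.sum_inner_mul_inner]
    exact Finset.sum_congr rfl fun i _ ↦ mul_comm _ _
  have hcard : ∑ i, ⟪e i, e i⟫ = 2 * (s : ℝ) + 1 := by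
    simp [hι]
  calc
    _ = ∑ i, ((((c - 3) / 4) * ⟪u, v⟫ - ((c + 1) / 4) * (⟪u, ξ⟫ * ⟪v, ξ⟫)) * ⟪e i, e i⟫
          - ((c - 3) / 4) * (⟪e i, v⟫ * ⟪u, e i⟫)
          + ((c + 1) / 4) * (⟪e i, φ v⟫ * ⟪φ u, e i⟫)
          + ((c + 1) / 2) * (⟪e i, φ u⟫ * ⟪φ v, e i⟫)
          + ((c + 1) / 4) * ⟪v, ξ⟫ * (⟪e i, ξ⟫ * ⟪u, e i⟫)
          + ((c + 1) / 4) * ⟪u, ξ⟫ * (⟪e i, v⟫ * ⟪ξ, e i⟫)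
          - ((c + 1) / 4) * ⟪u, v⟫ * (⟪e i, ξ⟫ * ⟪ξ, e i⟫)) := by
      refine Finset.sum_congr rfl fun i _ ↦ ?_
      simp only [inner_add_left, inner_sub_left, real_inner_smul_left, hdiag (e i),
        hskew (e i), real_inner_comm (e i) v, real_inner_comm u v]
      ring
    _ = _ := by
      simp only [Finset.sum_add_distrib, Finset.sum_sub_distrib, ← Finset.mul_sum, hpar, hcard,
        hφ, hξ, real_inner_comm u v, real_inner_comm u ξ]
      ring

end Pointwise

section Manifold

variable {E : Type*} [NormedAddCommGroup E] [NormedSpace ℝ E] [FiniteDimensional ℝ E]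
  {H : Type*} [TopologicalSpace H] {I : ModelWithCorners ℝ E H}
  {M : Type*} [TopologicalSpace M] [ChartedSpace H M] [IsManifold I ∞ M]
  [RiemannianBundle (fun x : M ↦ TangentSpace I x)]
  {φ : ∀ x : M, TangentSpace I x →L[ℝ] TangentSpace I x} {ξ : ∀ x : M, TangentSpace I x}

/-- The Ricci tensor of a field of constant `φ`-sectional curvature on an almost contact metric
manifold of dimension `2s + 1`. -/
theorem HasConstantPhiSectionalCurvature.ricci_eq
    (hM : IsAlmostContactMetric φ ξ) (s : ℕ) (hdim : Module.finrank ℝ E = 2 * s + 1)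
    {R : (X Y Z : ∀ x : M, TangentSpace I x) → ∀ x : M, TangentSpace I x} {c : ℝ}
    (hc : HasConstantPhiSectionalCurvature R φ ξ c) (x : M) (u v : TangentSpace I x) :
    ricci R x u v = ((c * (s + 1) - 3 * s + 1) / 2) * inner ℝ u v
      + (-((c + 1) * (s + 1)) / 2) * (inner ℝ u (ξ x) * inner ℝ v (ξ x)) := by
  have : FiniteDimensional ℝ (TangentSpace I x) := inferInstanceAs (FiniteDimensional ℝ E)
  have hext (w : TangentSpace I x) : SmoothAt (FiberBundle.extend E w) x :=
    FiberBundle.contMDiffAt_extend I E w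
  rw [ricci]
  simp only [hc x _ _ _ (hext _) (hext _) (hext _), FiberBundle.extend_apply_self]
  exact sum_inner_constantPhiSectionalCurvature (φ := (φ x).toLinearMap)
    (stdOrthonormalBasis ℝ (TangentSpace I x)) s ((Fintype.card_fin _).trans hdim)
    (hM.phi_phi x) (hM.phi_xi x) (hM.xi_xi x) (hM.inner_phi x) c u v

end Manifold

end Kenmotsu

theorem proposition3p12
    {E : Type*} [NormedAddCommGroup E] [NormedSpace ℝ E] [FiniteDimensional ℝ E]
    {H : Type*} [TopologicalSpace H] {I : ModelWithCorners ℝ E H} [I.Boundaryless]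
    {M : Type*} [TopologicalSpace M] [T2Space M] [SigmaCompactSpace M] [Nonempty M]
    [ChartedSpace H M] [IsManifold I ∞ M]
    [RiemannianBundle (fun x : M ↦ TangentSpace I x)]
    [IsContMDiffRiemannianBundle I ∞ E (fun x : M ↦ TangentSpace I x)]
    (s : ℕ) (hdim : Module.finrank ℝ E = 2 * s + 1)
    (D D₀ : Kenmotsu.AffineConnection I M)
    (φ : ∀ x : M, TangentSpace I x →L[ℝ] TangentSpace I x)
    (ξ : ∀ x : M, TangentSpace I x)
    (hM : Kenmotsu.IsKenmotsuStatistical D D₀ φ ξ)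
    (β : M → ℝ) (hβ : CMDiff ∞ β)
    (hK : ∀ (x : M) (u v : TangentSpace I x),
      Kenmotsu.differenceTensor D D₀ x u v
        = (β x * inner ℝ u (ξ x) * inner ℝ v (ξ x)) • ξ x)
    (R : (X Y Z : ∀ x : M, TangentSpace I x) → ∀ x : M, TangentSpace I x)
    (hR : R = Kenmotsu.statisticalCurvature D D₀ ∨ R = Kenmotsu.curvature D)
    (c : ℝ) (hc : Kenmotsu.HasConstantPhiSectionalCurvature R φ ξ c) :
    (∀ (x : M) (u v : TangentSpace I x),
      Kenmotsu.ricci R x u v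
        = ((c * (s + 1) - 3 * s + 1) / 2) * inner ℝ u v
          + (-((c + 1) * (s + 1)) / 2) * (inner ℝ u (ξ x) * inner ℝ v (ξ x)))
    ∧ (1 ≤ s → ¬ Kenmotsu.IsRicciFlat R)
    ∧ (∀ (x : M) (u : TangentSpace I x),
      Kenmotsu.ricci R x u (ξ x) = -2 * s * inner ℝ u (ξ x))
    ∧ (∀ (x : M) (u v : TangentSpace I x),
      Kenmotsu.ricci R x (φ x u) (φ x v)
        = Kenmotsu.ricci R x u v + 2 * s * (inner ℝ u (ξ x) * inner ℝ v (ξ x))) := by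
  have hA := hM.kenmotsu.toIsAlmostContactMetric
  have hric := hc.ricci_eq hA s hdim
  have hricξ (x : M) (u : TangentSpace I x) :
      Kenmotsu.ricci R x u (ξ x) = -2 * s * inner ℝ u (ξ x) := by
    rw [hric, hA.xi_xi]
    ring
  have hηφ (x : M) (u : TangentSpace I x) : inner ℝ (φ x u) (ξ x) = (0 : ℝ) :=
    Kenmotsu.inner_phi_xi_eq_zero (φ := (φ x).toLinearMap) (hA.phi_phi x) (hA.phi_xi x)
      (hA.xi_xi x) u
  refine ⟨hric, fun hs hflat ↦ ?_, hricξ, fun x u v ↦ ?_⟩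
  · obtain ⟨x⟩ := ‹Nonempty M›
    have h := hricξ x (ξ x)
    rw [hflat, hA.xi_xi] at h
    have hs' : (1 : ℝ) ≤ s := by exact_mod_cast hs
    linarith
  · rw [hric, hric, hA.inner_phi, hηφ, hηφ]
    ring
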